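/- Let $G$ be a finite group, let $\Delta(G)$ be the augmentation ideal of the integral group ring $\mathbb{Z}G$, let $\mathcal{V}(\mathbb{Z}G)$ be the group of units of augmentation one in $\mathbb{Z}G$, and put $\mathcal{V}_n(\mathbb{Z}G)=\mathcal{V}(\mathbb{Z}G)\cap(1+\Delta^n(G))$ for $n\ge 1$. Call $G$ a cut-group if every central unit of $\mathbb{Z}G$ is trivial, i.e. of the form $\pm g$ with $g\in G$. Then $\mathcal{V}_n(\mathbb{Z}G)=\{1\}$ for some $n\geq 1$ if and only if either (i) $G$ is an abelian cut-group; or (ii) $G\cong K_8\times E$, where $K_8$ is the quaternion group of order $8$ and $E$ is a (possibly trivial) elementary abelian $2$-group. Moreover, if $G$ is abelian, then $G$ is a cut-group if and only if the exponent of $G$ divides $4$ or $6$. -/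

import Mathlib

universe u

/-- The integral group ring `ℤG`. -/
abbrev IntGroupRing (G : Type*) [Group G] : Type _ := MonoidAlgebra ℤ G

/-- The augmentation map `ℤG → ℤ`, which sends every `g : G` to `1`. -/
noncomputable def augmentation (G : Type*) [Group G] : IntGroupRing G →ₐ[ℤ] ℤ :=
  MonoidAlgebra.lift ℤ ℤ G (1 : G →* ℤ)

/-- The augmentation ideal `Δ(G)` of `ℤG`. -/
noncomputable def augIdeal (G : Type*) [Group G] : Ideal (IntGroupRing G) :=
  RingHom.ker (augmentation G)

/-- The group `V(ℤG)` of normalized units: the units of `ℤG` of augmentation one. -/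
noncomputable def normalizedUnits (G : Type*) [Group G] : Subgroup (IntGroupRing G)ˣ :=
  (Units.map (augmentation G : IntGroupRing G →* ℤ)).ker

/-- The units of `ℤG` in `1 + Δⁿ(G)`. -/
noncomputable def deltaUnits (G : Type*) [Group G] (n : ℕ) : Subgroup (IntGroupRing G)ˣ where
  carrier := {u | (u : IntGroupRing G) - 1 ∈ augIdeal G ^ n}
  one_mem' := by simp
  mul_mem' := by
    intro u v hu hv
    have h : ((u * v : (IntGroupRing G)ˣ) : IntGroupRing G) - 1
        = (u : IntGroupRing G) * ((v : IntGroupRing G) - 1) + ((u : IntGroupRing G) - 1) := by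
      simp [mul_sub]
    simp only [Set.mem_ofPred_eq] at hu hv ⊢
    rw [h]
    exact Ideal.add_mem _ (Ideal.mul_mem_left _ _ hv) hu
  inv_mem' := by
    intro u hu
    have h : ((u⁻¹ : (IntGroupRing G)ˣ) : IntGroupRing G) - 1
        = -((u⁻¹ : (IntGroupRing G)ˣ) : IntGroupRing G) * ((u : IntGroupRing G) - 1) := by
      simp [mul_sub]; abel
    simp only [Set.mem_ofPred_eq] at hu ⊢
    rw [h]
    exact Ideal.mul_mem_left _ _ hu

/-- The filtration `Vₙ(ℤG) = V(ℤG) ∩ (1 + Δⁿ(G))`. -/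
noncomputable def unitFiltration (G : Type*) [Group G] (n : ℕ) : Subgroup (IntGroupRing G)ˣ :=
  normalizedUnits G ⊓ deltaUnits G n

/-- `G` is a cut-group: all central units of `ℤG` are trivial, that is, of the form `±g`. -/
def IsCutGroup (G : Type*) [Group G] : Prop :=
  ∀ u : (IntGroupRing G)ˣ, (u : IntGroupRing G) ∈ Set.center (IntGroupRing G) →
    ∃ g : G, (u : IntGroupRing G) = MonoidAlgebra.of ℤ G g ∨
      (u : IntGroupRing G) = -MonoidAlgebra.of ℤ G g

/-! Suppose some `Vₙ` is trivial. Reduction modulo a power of |G| lands in a finite ring, and a high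
enough power of |G| carries `Δ(G)` into any prescribed `Δⁿ(G)`, so every normalized unit has a power
in `Vₙ` and is therefore torsion. Bass units then force every element order to divide 4 or 6
(`exists_normalizedUnit_not_isOfFinOrder`), and bicyclic units force cyclic subgroups to be normal
(`exists_mul_eq_mul_pow`). A cyclic group of such an order has no automorphisms but the identity and
inversion, so noncommuting elements invert each other. A nonabelian group of this kind is K₈ × E
(`exists_mulEquiv_quaternionGroup_prod`).

Conversely, the listed groups have only the units ±g. Under suitable representations, units go to ℤ,
to ℤ + ℤω with ω = i or a primitive sixth root of unity, or to the integral quaternions, where an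
integral norm shows that they have absolute value one. Parseval's identity turns this into ∑
(coefficients)² = 1. Finally, additive functions on G kill `Δ²(G)` and certain quadratic ones kill
`Δ³(G)`, which separates the group elements from 1 and makes `V₂` trivial for abelian cut-groups and
`V₃` for K₈ × E. -/

open MonoidAlgebra

/-! ### Powers of the augmentation ideal and torsion of normalized units. -/

section Augmentation

variable {G : Type*} [Group G]

theorem augmentation_single (g : G) (r : ℤ) : augmentation G (single g r) = r := by
  simp [augmentation]

theorem augmentation_of (g : G) : augmentation G (of ℤ G g) = 1 := augmentation_single g 1

theorem mem_augIdeal {x : IntGroupRing G} : x ∈ augIdeal G ↔ augmentation G x = 0 :=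
  RingHom.mem_ker

instance : (augIdeal G).IsTwoSided :=
  inferInstanceAs (RingHom.ker (augmentation G)).IsTwoSided

theorem of_sub_one_mem_augIdeal (g : G) : of ℤ G g - 1 ∈ augIdeal G := by
  rw [mem_augIdeal, map_sub, augmentation_of, map_one, sub_self]

theorem mem_normalizedUnits {u : (IntGroupRing G)ˣ} :
    u ∈ normalizedUnits G ↔ augmentation G (u : IntGroupRing G) = 1 := by
  rw [normalizedUnits, MonoidHom.mem_ker, Units.ext_iff]
  rfl

theorem mem_unitFiltration {u : (IntGroupRing G)ˣ} {n : ℕ} :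
    u ∈ unitFiltration G n ↔ augmentation G (u : IntGroupRing G) = 1 ∧
      (u : IntGroupRing G) - 1 ∈ augIdeal G ^ n := by
  rw [unitFiltration, Subgroup.mem_inf, mem_normalizedUnits]
  rfl

theorem augmentation_mapDomain {H : Type*} [Group H] (f : G →* H) (x : IntGroupRing G) :
    augmentation H (mapDomainRingHom ℤ f x) = augmentation G x := by
  induction x using MonoidAlgebra.induction_linear with
  | zero => simp
  | add x y hx hy => simp only [map_add, hx, hy]
  | single g r => simp [augmentation_single]

theorem mapDomain_mem_augIdeal_pow {H : Type*} [Group H] (f : G →* H) {n : ℕ}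
    {x : IntGroupRing G} (hx : x ∈ augIdeal G ^ n) :
    mapDomainRingHom ℤ f x ∈ augIdeal H ^ n := by
  induction n generalizing x with
  | zero => rw [Submodule.pow_zero, Ideal.one_eq_top]; trivial
  | succ n ih =>
    rw [Submodule.pow_succ] at hx ⊢
    induction hx using Submodule.mul_induction_on' with
    | mem_mul_mem a ha b hb =>
      rw [map_mul]
      refine Ideal.mul_mem_mul (ih ha) ?_
      rw [mem_augIdeal] at hb ⊢
      rw [augmentation_mapDomain, hb]
    | add a _ b _ ha hb => rw [map_add]; exact Ideal.add_mem _ ha hb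

/-- Since 0 = (1 + g + ⋯ + g^(e-1))(g - 1) and the first factor is congruent to e modulo Δ, the
element e(g - 1) is in Δ². -/
theorem nsmul_of_sub_one_mem {e : ℕ} {g : G} (he : g ^ e = 1) :
    e • (of ℤ G g - 1) ∈ augIdeal G ^ 2 := by
  have h1 : (∑ i ∈ Finset.range e, of ℤ G g ^ i) * (of ℤ G g - 1) = 0 := by
    rw [geom_sum_mul, ← map_pow, he, map_one, sub_self]
  have h2 : e • (of ℤ G g - 1) =
      -((∑ i ∈ Finset.range e, (of ℤ G (g ^ i) - 1)) * (of ℤ G g - 1)) := by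
    simp only [map_pow, Finset.sum_sub_distrib, sub_mul _ _ (of ℤ G g - 1), h1]
    simp
  rw [h2, Submodule.pow_succ, Submodule.pow_one]
  exact Submodule.neg_mem _ (Ideal.mul_mem_mul
    (Ideal.sum_mem _ fun i _ => of_sub_one_mem_augIdeal _) (of_sub_one_mem_augIdeal g))

theorem nsmul_mem_augIdeal_sq {e : ℕ} (he : ∀ g : G, g ^ e = 1) {x : IntGroupRing G}
    (hx : x ∈ augIdeal G) : e • x ∈ augIdeal G ^ 2 := by
  have key : ∀ y : IntGroupRing G,
      e • (y - algebraMap ℤ _ (augmentation G y)) ∈ augIdeal G ^ 2 := by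
    intro y
    induction y using MonoidAlgebra.induction_linear with
    | zero => simp
    | add x y hx hy =>
      have : e • (x + y - algebraMap ℤ (IntGroupRing G) (augmentation G (x + y))) =
          e • (x - algebraMap ℤ _ (augmentation G x)) +
            e • (y - algebraMap ℤ _ (augmentation G y)) := by
        rw [map_add, map_add, ← smul_add]; congr 1; abel
      rw [this]; exact Ideal.add_mem _ hx hy
    | single g r =>
      have : e • (single g r - algebraMap ℤ (IntGroupRing G) (augmentation G (single g r))) =
          algebraMap ℤ (IntGroupRing G) r * (e • (of ℤ G g - 1)) := by
        rw [augmentation_single, mul_smul_comm, mul_sub, mul_one,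
          MonoidAlgebra.single_eq_algebraMap_mul_of]
      rw [this]
      exact Ideal.mul_mem_left _ _ (nsmul_of_sub_one_mem (he g))
  have := key x
  rwa [mem_augIdeal.1 hx, map_zero, sub_zero] at this

theorem nsmul_mem_augIdeal_pow_succ {e : ℕ} (he : ∀ g : G, g ^ e = 1) {n : ℕ}
    {x : IntGroupRing G} (hx : x ∈ augIdeal G ^ (n + 1)) : e • x ∈ augIdeal G ^ (n + 2) := by
  rw [Submodule.pow_succ] at hx
  rw [Ideal.IsTwoSided.pow_add]
  induction hx using Submodule.mul_induction_on' with
  | mem_mul_mem a ha b hb =>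
    rw [← mul_smul_comm]
    exact Ideal.mul_mem_mul ha (nsmul_mem_augIdeal_sq he hb)
  | add a _ b _ ha hb => rw [smul_add]; exact Ideal.add_mem _ ha hb

theorem pow_nsmul_mem_augIdeal_pow {e : ℕ} (he : ∀ g : G, g ^ e = 1) (n : ℕ)
    {x : IntGroupRing G} (hx : x ∈ augIdeal G) : e ^ n • x ∈ augIdeal G ^ (n + 1) := by
  induction n with
  | zero => simpa [Submodule.pow_one] using hx
  | succ n ih =>
    rw [pow_succ', mul_smul]
    exact nsmul_mem_augIdeal_pow_succ he ih

/-- The group ring over ℤ/N is finite, so the image of u there has finite order. -/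
theorem exists_pow_eq_one_add_nsmul [Finite G] (u : (IntGroupRing G)ˣ) {N : ℕ} (hN : N ≠ 0) :
    ∃ k, 0 < k ∧ ∃ x : IntGroupRing G, (u : IntGroupRing G) ^ k = 1 + N • x := by
  have : NeZero N := ⟨hN⟩
  let φ := mapRingHom G (Int.castRingHom (ZMod N))
  have : Finite (MonoidAlgebra (ZMod N) G) :=
    Finite.of_injective (fun x => (x.coeff : G → ZMod N))
      (DFunLike.coe_injective.comp coeff_injective)
  obtain ⟨k, hk, h⟩ := (isOfFinOrder_of_finite (Units.map φ.toMonoidHom u)).exists_pow_eq_one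
  refine ⟨k, hk, ?_⟩
  have h1 : φ ((u : IntGroupRing G) ^ k - 1) = 0 := by
    have := congrArg Units.val h
    rw [map_sub, map_pow, map_one, sub_eq_zero]
    simpa using this
  generalize hy : (u : IntGroupRing G) ^ k - 1 = y at h1
  have h2 : ∀ g, (N : ℤ) ∣ y.coeff g := by
    intro g
    rw [← ZMod.intCast_zmod_eq_zero_iff_dvd]
    have := congrArg (fun y => y.coeff g) h1
    simpa [φ] using this
  refine ⟨ofCoeff (y.coeff.mapRange (· / (N : ℤ)) (by simp)), ?_⟩
  rw [← sub_eq_iff_eq_add', hy]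
  ext g
  rw [coeff_smul_apply, Finsupp.mapRange_apply, nsmul_eq_mul]
  exact (Int.mul_ediv_cancel' (h2 g)).symm

/-- Some power of each normalized unit lies in any given term of the filtration. -/
theorem exists_pow_mem_unitFiltration [Finite G] {u : (IntGroupRing G)ˣ}
    (hu : u ∈ normalizedUnits G) (n : ℕ) : ∃ k, 0 < k ∧ u ^ k ∈ unitFiltration G (n + 1) := by
  have hc : Nat.card G ≠ 0 := Nat.card_pos.ne'
  -- The modulus is |G|ⁿ because |G| annihilates each quotient Δ^j/Δ^(j+1) with j ≥ 1.
  obtain ⟨k, hk, x, hx⟩ := exists_pow_eq_one_add_nsmul u (pow_ne_zero n hc)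
  refine ⟨k, hk, mem_unitFiltration.2 ⟨?_, ?_⟩⟩
  · exact mem_normalizedUnits.1 (Subgroup.pow_mem _ hu k)
  · rw [mem_normalizedUnits] at hu
    have h0 : x ∈ augIdeal G := by
      have := congrArg (augmentation G) hx
      rw [map_pow, hu, map_add, map_nsmul, one_pow, map_one, left_eq_add, nsmul_eq_mul,
        mul_eq_zero] at this
      exact mem_augIdeal.2 (this.resolve_left (by exact_mod_cast pow_ne_zero n hc))
    rw [Units.val_pow_eq_pow_val, hx, add_sub_cancel_left]
    exact pow_nsmul_mem_augIdeal_pow (fun g => pow_card_eq_one') n h0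

theorem isOfFinOrder_of_unitFiltration_eq_bot [Finite G] {n : ℕ} (hn : 1 ≤ n)
    (h : unitFiltration G n = ⊥) {u : (IntGroupRing G)ˣ} (hu : u ∈ normalizedUnits G) :
    IsOfFinOrder u := by
  obtain ⟨m, rfl⟩ := Nat.exists_eq_add_of_le' hn
  obtain ⟨k, hk, hm⟩ := exists_pow_mem_unitFiltration hu m
  rw [h, Subgroup.mem_bot] at hm
  exact isOfFinOrder_iff_pow_eq_one.2 ⟨k, hk, hm⟩

end Augmentation

/-! ### Bass units of infinite order. -/

section BassUnits

theorem geom_sum_mul_geom_sum_pow {R : Type*} [CommRing R] (t : R) (k l : ℕ) :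
    (∑ i ∈ Finset.range k, t ^ i) * ∑ j ∈ Finset.range l, (t ^ k) ^ j =
      ∑ i ∈ Finset.range (k * l), t ^ i := by
  induction l with
  | zero => simp
  | succ l ih =>
    rw [Finset.sum_range_succ, mul_add, ih, mul_add_one, Finset.sum_range_add, ← pow_mul,
      Finset.sum_mul]
    congr 1
    exact Finset.sum_congr rfl fun i _ => by ring

section

variable {R : Type*} [CommRing R] {t : R} {n : ℕ}

theorem pow_mul_geom_sum_eq (ht : t ^ n = 1) (i : ℕ) :
    t ^ i * ∑ j ∈ Finset.range n, t ^ j = ∑ j ∈ Finset.range n, t ^ j := by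
  induction i with
  | zero => simp
  | succ i ih =>
    have h : t * ∑ j ∈ Finset.range n, t ^ j = ∑ j ∈ Finset.range n, t ^ j := by
      have := mul_geom_sum t n
      rw [ht, sub_self, sub_mul, one_mul, sub_eq_zero] at this
      exact this
    rw [pow_succ, mul_assoc, h, ih]

theorem geom_sum_one_add_mul (ht : t ^ n = 1) (q : ℕ) :
    ∑ i ∈ Finset.range (1 + n * q), t ^ i = 1 + q * ∑ j ∈ Finset.range n, t ^ j := by
  induction q with
  | zero => simp
  | succ q ih =>
    rw [mul_add_one, ← add_assoc, Finset.sum_range_add, ih]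
    simp_rw [pow_add _ (1 + n * q)]
    rw [← Finset.mul_sum, pow_mul_geom_sum_eq ht]
    push_cast
    ring

theorem geom_sum_mul_norm (ht : t ^ n = 1) (a k : ℕ) :
    (∑ i ∈ Finset.range k, (t ^ a) ^ i) * ∑ j ∈ Finset.range n, t ^ j =
      k * ∑ j ∈ Finset.range n, t ^ j := by
  rw [Finset.sum_mul]
  simp_rw [← pow_mul, pow_mul_geom_sum_eq ht]
  simp

end

theorem pow_mul_eq_of_mul_eq {R : Type*} [CommRing R] {x S : R} {r : R} (h : x * S = r * S)
    (m : ℕ) : x ^ m * S = r ^ m * S := by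
  induction m with
  | zero => simp
  | succ m ih => rw [pow_succ, mul_assoc, h, ← mul_assoc, mul_comm _ r, mul_assoc, ih]; ring

theorem exists_one_add_mul_pow {R : Type*} [CommRing R] {S : R} {n : ℤ} (hS : S * S = n * S)
    (q : ℤ) (m : ℕ) : ∃ Q : ℤ, (1 + q * S) ^ m = 1 + Q * S ∧ n * Q = (1 + n * q) ^ m - 1 := by
  induction m with
  | zero => exact ⟨0, by simp⟩
  | succ m ih =>
    obtain ⟨Q, h1, h2⟩ := ih
    refine ⟨Q + q + n * Q * q, ?_, ?_⟩
    · rw [pow_succ, h1]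
      push_cast
      linear_combination (Q : R) * q * hS
    · rw [pow_succ]
      linear_combination (1 + n * q) * h2

/-- The element `(1 + t + ⋯ + t ^ (k - 1)) ^ m + c (1 + t + ⋯ + t ^ (n - 1))`. -/
def bassElement {R : Type*} [CommRing R] (t : R) (n k m : ℕ) (c : ℤ) : R :=
  (∑ i ∈ Finset.range k, t ^ i) ^ m + c * ∑ j ∈ Finset.range n, t ^ j

/-- With S = 1 + ⋯ + t^(n-1), the geometric sum of length l in t^k inverts the one of length k in t
modulo S, because kl ≡ 1 mod n. The multiples cS and dS are chosen to absorb the error. -/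
theorem isUnit_bassElement {R : Type*} [CommRing R] {t : R} {n k l q m : ℕ} {c d : ℤ}
    (hn : n ≠ 0) (ht : t ^ n = 1) (hkl : k * l = 1 + n * q) (hc : n * c = 1 - (k : ℤ) ^ m)
    (hd : n * d = 1 - (l : ℤ) ^ m) : IsUnit (bassElement t n k m c) := by
  rw [bassElement]
  have hA := pow_mul_eq_of_mul_eq (by simpa using geom_sum_mul_norm ht 1 k) m
  have hB := pow_mul_eq_of_mul_eq (geom_sum_mul_norm ht k l) m
  have hS : (∑ j ∈ Finset.range n, t ^ j) * ∑ j ∈ Finset.range n, t ^ j =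
      (n : ℤ) * ∑ j ∈ Finset.range n, t ^ j := by
    simpa using geom_sum_mul_norm ht 1 n
  have hAB := geom_sum_mul_geom_sum_pow t k l
  rw [hkl, geom_sum_one_add_mul ht] at hAB
  obtain ⟨Q, hQ, hnQ⟩ := exists_one_add_mul_pow hS q m
  set S := ∑ j ∈ Finset.range n, t ^ j
  set A := ∑ i ∈ Finset.range k, t ^ i
  set B := ∑ j ∈ Finset.range l, (t ^ k) ^ j
  refine IsUnit.of_mul_eq_one (B ^ m + d * S) ?_
  -- This is the coefficient of S in the product, since A, B and S multiply S by k, l and n. It is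
  -- checked after multiplication by n.
  have hsum : Q + d * (k : ℤ) ^ m + c * (l : ℤ) ^ m + c * d * n = 0 := by
    have hkl' : (1 + n * q : ℤ) = k * l := by exact_mod_cast hkl.symm
    rw [hkl', mul_pow] at hnQ
    have hn' : (n : ℤ) ≠ 0 := by exact_mod_cast hn
    apply mul_left_cancel₀ hn'
    linear_combination hnQ + (k : ℤ) ^ m * hd + (l : ℤ) ^ m * hc + n * d * hc
      + (1 - (k : ℤ) ^ m) * hd
  have hsum' : (Q + d * (k : R) ^ m + c * (l : R) ^ m + c * d * n) = 0 := by
    exact_mod_cast congrArg (Int.cast : ℤ → R) hsum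
  have hABm : A ^ m * B ^ m = 1 + Q * S := by
    rw [← mul_pow, hAB, ← hQ, Int.cast_natCast]
  push_cast at hS
  linear_combination hABm + (d : R) * hA + (c : R) * hB + (c : R) * d * hS + S * hsum'

theorem map_bassElement {R R' : Type*} [CommRing R] [CommRing R'] (f : R →+* R') (t : R)
    (n k m : ℕ) (c : ℤ) : f (bassElement t n k m c) = bassElement (f t) n k m c := by
  simp [bassElement]

/-- On the unit circle the distance to 1 determines the real part, hence the point up to
conjugation. -/
theorem Complex.eq_or_mul_eq_one_of_norm_sub_one {z w : ℂ} (hz : ‖z‖ = 1) (hw : ‖w‖ = 1)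
    (h : ‖z - 1‖ = ‖w - 1‖) : z = w ∨ z * w = 1 := by
  have hz' : z.re * z.re + z.im * z.im = 1 := by
    rw [← Complex.normSq_apply, Complex.normSq_eq_norm_sq, hz, one_pow]
  have hw' : w.re * w.re + w.im * w.im = 1 := by
    rw [← Complex.normSq_apply, Complex.normSq_eq_norm_sq, hw, one_pow]
  have h' : Complex.normSq (z - 1) = Complex.normSq (w - 1) := by
    rw [Complex.normSq_eq_norm_sq, Complex.normSq_eq_norm_sq, h]
  simp only [Complex.normSq_apply, Complex.sub_re, Complex.sub_im, Complex.one_re,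
    Complex.one_im] at h'
  have hre : z.re = w.re := by linarith
  have him : (z.im - w.im) * (z.im + w.im) = 0 := by
    rw [hre] at hz'
    linarith
  rcases mul_eq_zero.1 him with h0 | h0
  · exact Or.inl (Complex.ext hre (sub_eq_zero.1 h0))
  · right
    have h1 : z.im = -w.im := eq_neg_of_add_eq_zero_left h0
    apply Complex.ext
    · rw [Complex.mul_re, hre, h1, Complex.one_re]; linarith
    · rw [Complex.mul_im, hre, h1, Complex.one_im]; ring

/-- The sum is (ζ^k - 1)/(ζ - 1), so absolute value one would give ζ^k = ζ or ζ^k = ζ⁻¹. -/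
theorem IsPrimitiveRoot.norm_geom_sum_ne_one {n k : ℕ} {ζ : ℂ} (hζ : IsPrimitiveRoot ζ n)
    (h1 : 1 < k) (hk : k + 1 < n) : ‖∑ i ∈ Finset.range k, ζ ^ i‖ ≠ 1 := by
  intro h
  have hn : n ≠ 0 := by omega
  have hnorm : ‖ζ‖ = 1 := hζ.norm'_eq_one hn
  have h2 : ‖ζ ^ k - 1‖ = ‖ζ - 1‖ := by
    rw [← geom_sum_mul, norm_mul, h, one_mul]
  rcases Complex.eq_or_mul_eq_one_of_norm_sub_one (by rw [norm_pow, hnorm, one_pow]) hnorm h2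
    with h3 | h3
  · have := hζ.pow_inj (i := k) (j := 1) (by omega) (by omega) (by rw [h3, pow_one])
    omega
  · rw [← pow_succ] at h3
    exact absurd (Nat.le_of_dvd (by omega) (hζ.dvd_of_pow_eq_one _ h3)) (by omega)

/-- Such n are 5 or at least 7. The witness is 2 for odd n, and 2j - 1 for n = 4j or n = 4j + 2. -/
theorem exists_coprime_of_not_dvd {n : ℕ} (hn : n ≠ 0) (h4 : ¬ n ∣ 4) (h6 : ¬ n ∣ 6) :
    ∃ k, 1 < k ∧ k + 1 < n ∧ Nat.Coprime k n := by
  have h7 : n = 5 ∨ 7 ≤ n := by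
    by_contra h
    have : n ≤ 6 := by omega
    interval_cases n <;> simp_all
  rcases Nat.even_or_odd' n with ⟨m, rfl | rfl⟩
  · rcases Nat.even_or_odd' m with ⟨j, rfl | rfl⟩
    · refine ⟨2 * j - 1, by omega, by omega, ?_⟩
      have h : Nat.Coprime (2 * j - 1) (2 * j) := by
        have := Nat.coprime_self_add_right (m := 2 * j - 1) (n := 1)
        rw [show 2 * j - 1 + 1 = 2 * j by omega] at this
        simpa using this
      exact Nat.Coprime.mul_right (Nat.Coprime.coprime_mul_right_right h) h
    · refine ⟨2 * j - 1, by omega, by omega, ?_⟩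
      have h : Nat.Coprime (2 * j - 1) 2 := by
        rw [Nat.coprime_two_right]
        exact ⟨j - 1, by omega⟩
      refine Nat.Coprime.mul_right h ?_
      have := Nat.coprime_self_add_right (m := 2 * j - 1) (n := 2)
      rw [show 2 * j - 1 + 2 = 2 * j + 1 by omega] at this
      exact this.2 h
  · exact ⟨2, by omega, by omega, by simp⟩

/-- A cyclic group whose order divides neither `4` nor `6` has a normalized unit of infinite
order in its integral group ring. -/
theorem exists_normalizedUnit_not_isOfFinOrder_of_generator {C : Type*} [CommGroup C] {g : C}
    (hgen : ∀ x : C, x ∈ Subgroup.zpowers g) {n : ℕ} (hord : orderOf g = n) (hn : n ≠ 0)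
    (h4 : ¬ n ∣ 4) (h6 : ¬ n ∣ 6) : ∃ u ∈ normalizedUnits C, ¬ IsOfFinOrder u := by
  obtain ⟨k, hk1, hkn, hcop⟩ := exists_coprime_of_not_dvd hn h4 h6
  obtain ⟨l, hl⟩ := Nat.exists_mul_mod_eq_one_of_coprime hcop (by omega)
  have hkl : k * l = 1 + n * (k * l / n) := by rw [← hl.2, Nat.mod_add_div]
  have hlcop : Nat.Coprime l n := by
    have : Nat.Coprime (k * l) n := by rw [hkl]; simp
    exact this.coprime_mul_left
  have hdvd : ∀ j : ℕ, Nat.Coprime j n → ∃ c : ℤ, n * c = 1 - (j : ℤ) ^ n.totient := by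
    intro j hj
    have := (Nat.modEq_iff_dvd.1 (Nat.ModEq.pow_totient hj))
    push_cast at this
    obtain ⟨c, hc⟩ := this
    exact ⟨c, hc.symm⟩
  obtain ⟨c, hc⟩ := hdvd k hcop
  obtain ⟨d, hd⟩ := hdvd l hlcop
  have hgn : of ℤ C g ^ n = 1 := by rw [← map_pow, ← hord, pow_orderOf_eq_one, map_one]
  obtain ⟨u, hu⟩ := isUnit_bassElement hn hgn hkl hc hd
  refine ⟨u, ?_, ?_⟩
  · rw [mem_normalizedUnits, hu]
    have := map_bassElement (augmentation C).toRingHom (of ℤ C g) n k n.totient c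
    refine this.trans ?_
    have h1 : (augmentation C).toRingHom (of ℤ C g) = 1 := augmentation_of g
    rw [h1]
    simp only [bassElement, one_pow, Finset.sum_const, Finset.card_range, nsmul_eq_mul, mul_one,
      Int.cast_id]
    linarith
  · intro hfin
    obtain ⟨j, hj, hpow⟩ := hfin.exists_pow_eq_one
    have hζ := Complex.isPrimitiveRoot_exp n hn
    set ζ := Complex.exp (2 * Real.pi * Complex.I / n)
    have hζ' : orderOf (hζ.isUnit hn).unit ∣ orderOf g := by
      rw [hord]
      apply orderOf_dvd_of_pow_eq_one
      ext
      simpa using hζ.pow_eq_one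
    -- A faithful character kills 1 + g + ⋯ + g^(n-1), leaving a power of a geometric sum in ζ,
    -- which is off the unit circle.
    let χ : IntGroupRing C →ₐ[ℤ] ℂ := MonoidAlgebra.lift ℤ ℂ C
      ((Units.coeHom ℂ).comp (monoidHomOfForallMemZpowers hgen hζ'))
    have hχ : χ (of ℤ C g) = ζ := by
      simp only [χ]
      rw [lift_of, MonoidHom.comp_apply, monoidHomOfForallMemZpowers_apply_gen]
      rfl
    have hχu : χ (u : IntGroupRing C) = (∑ i ∈ Finset.range k, ζ ^ i) ^ n.totient := by
      rw [hu]
      have := map_bassElement χ.toRingHom (of ℤ C g) n k n.totient c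
      refine this.trans ?_
      have h1 : χ.toRingHom (of ℤ C g) = ζ := hχ
      rw [h1, bassElement, hζ.geom_sum_eq_zero (by omega), mul_zero, add_zero]
    have h1 : ‖χ (u : IntGroupRing C)‖ ^ j = 1 := by
      rw [← norm_pow, ← map_pow, ← Units.val_pow_eq_pow_val, hpow]
      simp
    rw [hχu, norm_pow, ← pow_mul, pow_eq_one_iff_of_nonneg (norm_nonneg _)
      (mul_ne_zero (Nat.totient_pos.2 (by omega)).ne' hj.ne')] at h1
    exact hζ.norm_geom_sum_ne_one hk1 hkn h1

theorem exists_normalizedUnit_not_isOfFinOrder {G : Type*} [Group G] {g : G}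
    (hg : IsOfFinOrder g) (h4 : ¬ orderOf g ∣ 4) (h6 : ¬ orderOf g ∣ 6) :
    ∃ u ∈ normalizedUnits G, ¬ IsOfFinOrder u := by
  have hgen : ∀ x : Multiplicative (ZMod (orderOf g)),
      x ∈ Subgroup.zpowers (Multiplicative.ofAdd (1 : ZMod (orderOf g))) := by
    intro x
    obtain ⟨j, hj⟩ := ZMod.intCast_surjective (Multiplicative.toAdd x)
    exact ⟨j, Multiplicative.toAdd.injective (by simp [hj])⟩
  obtain ⟨u, hu, hinf⟩ := exists_normalizedUnit_not_isOfFinOrder_of_generator hgen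
    (by rw [orderOf_ofAdd_eq_addOrderOf, ZMod.addOrderOf_one]) hg.orderOf_pos.ne' h4 h6
  let f : Multiplicative (ZMod (orderOf g)) →* G :=
    AddMonoidHom.toMultiplicativeLeft
      (ZMod.lift (orderOf g) ⟨zmultiplesHom (Additive G) (Additive.ofMul g), by
        simp [← ofMul_pow, pow_orderOf_eq_one]⟩)
  have hf : Function.Injective f := by
    have := (ZMod.lift_injective (orderOf g) (f := ⟨zmultiplesHom (Additive G) (Additive.ofMul g),
        by simp [← ofMul_pow, pow_orderOf_eq_one]⟩)).2 (by
      intro m hm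
      rw [ZMod.intCast_zmod_eq_zero_iff_dvd, orderOf_dvd_iff_zpow_eq_one]
      simpa [← ofMul_zpow] using hm)
    exact fun a b hab => Multiplicative.toAdd.injective (this hab)
  have hinj : Function.Injective (Units.map (mapDomainRingHom ℤ f).toMonoidHom) :=
    Units.map_injective (mapDomain_injective hf)
  refine ⟨Units.map (mapDomainRingHom ℤ f).toMonoidHom u, ?_, ?_⟩
  · rw [mem_normalizedUnits] at hu ⊢
    exact (augmentation_mapDomain f _).trans hu
  · rwa [hinj.isOfFinOrder_iff]

end BassUnits

/-! ### Trivial units of abelian groups of exponent dividing 4 or 6. -/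

section TrivialUnits

/-- All units of `ℤG` are of the form `±g`. -/
def HasTrivialUnits (G : Type*) [Group G] : Prop :=
  ∀ u : (IntGroupRing G)ˣ, ∃ g : G, (u : IntGroupRing G) = of ℤ G g ∨
    (u : IntGroupRing G) = -of ℤ G g

theorem HasTrivialUnits.isCutGroup {G : Type*} [Group G] (h : HasTrivialUnits G) :
    IsCutGroup G := fun u _ => h u

theorem IsCutGroup.hasTrivialUnits {G : Type*} [CommGroup G] (h : IsCutGroup G) :
    HasTrivialUnits G := fun u => h u (by rw [Set.center_eq_univ]; trivial)

theorem HasTrivialUnits.of_mulEquiv {G H : Type*} [Group G] [Group H] (e : G ≃* H)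
    (h : HasTrivialUnits H) : HasTrivialUnits G := by
  intro u
  obtain ⟨k, hk⟩ := h (Units.map (mapDomainRingEquiv ℤ e).toMonoidHom u)
  have hof : mapDomainRingEquiv ℤ e (of ℤ G (e.symm k)) = of ℤ H k := by simp
  refine ⟨e.symm k, hk.imp (fun h1 => ?_) (fun h1 => ?_)⟩
  · apply (mapDomainRingEquiv ℤ e).injective
    rw [hof]; exact h1
  · apply (mapDomainRingEquiv ℤ e).injective
    rw [map_neg, hof]; exact h1

theorem exists_eq_of_sum_sq_eq_one {G : Type*} [Group G] [Fintype G] {x : IntGroupRing G}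
    (h : ∑ g, x.coeff g ^ 2 = 1) : ∃ g : G, x = of ℤ G g ∨ x = -of ℤ G g := by
  classical
  obtain ⟨g, -, hg⟩ : ∃ g ∈ Finset.univ, x.coeff g ^ 2 ≠ 0 := by
    apply Finset.exists_ne_zero_of_sum_ne_zero
    rw [h]; exact one_ne_zero
  rw [← Finset.add_sum_erase _ _ (Finset.mem_univ g)] at h
  have h0 : 0 ≤ ∑ k ∈ Finset.univ.erase g, x.coeff k ^ 2 :=
    Finset.sum_nonneg fun k _ => sq_nonneg _
  have h1 : 0 < x.coeff g ^ 2 := lt_of_le_of_ne (sq_nonneg _) (Ne.symm hg)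
  have h2 : ∑ k ∈ Finset.univ.erase g, x.coeff k ^ 2 = 0 := by omega
  have h3 : x.coeff g ^ 2 = 1 := by omega
  rw [Finset.sum_eq_zero_iff_of_nonneg fun k _ => sq_nonneg _] at h2
  have hx : x = single g (x.coeff g) := by
    ext k
    by_cases hk : k = g
    · subst hk; simp
    · rw [coeff_single, Finsupp.single_eq_of_ne hk]
      exact pow_eq_zero_iff two_ne_zero |>.1 (h2 k (by simp [hk]))
  refine ⟨g, (sq_eq_one_iff.1 h3).imp (fun h => ?_) (fun h => ?_)⟩
  · rw [hx, h]; rfl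
  · rw [hx, h]; ext; simp

theorem lift_eq_sum {G A : Type*} [Group G] [Fintype G] [Ring A] [Algebra ℤ A] (f : G →* A)
    (x : IntGroupRing G) : MonoidAlgebra.lift ℤ A G f x = ∑ g, x.coeff g * f g := by
  rw [lift_apply, Finsupp.sum_fintype _ _ fun _ => by
    rw [Algebra.smul_def, map_zero, zero_mul]]
  simp [Algebra.smul_def]

/-- The multiplicative character of `G` attached to an additive character of `Additive G`. -/
def AddChar.toHom {G : Type*} [Group G] (ψ : AddChar (Additive G) ℂ) : G →* ℂ where
  toFun g := ψ (Additive.ofMul g)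
  map_one' := by simp
  map_mul' := by simp [AddChar.map_add_eq_mul]

/-- Parseval's identity, from orthogonality of characters. -/
theorem sum_normSq_lift {G : Type*} [CommGroup G] [Fintype G] (x : IntGroupRing G) :
    ∑ ψ : AddChar (Additive G) ℂ, Complex.normSq (MonoidAlgebra.lift ℤ ℂ G ψ.toHom x) =
      Fintype.card G * ∑ g, (x.coeff g : ℝ) ^ 2 := by
  classical
  have h : ∀ ψ : AddChar (Additive G) ℂ,
      (Complex.normSq (MonoidAlgebra.lift ℤ ℂ G ψ.toHom x) : ℂ) =
        ∑ g, ∑ k, (x.coeff g * x.coeff k : ℂ) * ψ (Additive.ofMul g - Additive.ofMul k) := by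
    intro ψ
    rw [← Complex.mul_conj, lift_eq_sum, map_sum, Finset.sum_mul_sum]
    refine Finset.sum_congr rfl fun g _ => Finset.sum_congr rfl fun k _ => ?_
    rw [sub_eq_add_neg, AddChar.map_add_eq_mul, AddChar.map_neg_eq_conj, map_mul,
      map_intCast]
    simp only [AddChar.toHom, MonoidHom.coe_mk, OneHom.coe_mk]
    ring
  apply Complex.ofReal_injective
  push_cast
  simp_rw [h]
  rw [Finset.sum_comm]
  simp_rw [Finset.sum_comm (s := (Finset.univ : Finset (AddChar (Additive G) ℂ))),
    ← Finset.mul_sum, AddChar.sum_apply_eq_ite, sub_eq_zero]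
  simp [Finset.mul_sum, mul_comm, pow_two]

/-- The values of a character of exponent `e` lie in the lattice `ℤ + ℤω`, on which the squared
absolute value is a positive definite integral form, so units have absolute value one. -/
theorem hasTrivialUnits_of_roots {G : Type*} [CommGroup G] [Finite G] {e : ℕ}
    (he : ∀ g : G, g ^ e = 1) {ω : ℂ} {t : ℤ} (hre : 2 * ω.re = t) (hω : Complex.normSq ω = 1)
    (hroots : ∀ z : ℂ, z ^ e = 1 → ∃ a b : ℤ, z = a + b * ω) : HasTrivialUnits G := by
  have := Fintype.ofFinite G
  intro u
  have hint : ∀ (ψ : AddChar (Additive G) ℂ) (x : IntGroupRing G),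
      ∃ m : ℕ, Complex.normSq (MonoidAlgebra.lift ℤ ℂ G ψ.toHom x) = m := by
    intro ψ x
    have hmem : ∃ a b : ℤ, MonoidAlgebra.lift ℤ ℂ G ψ.toHom x = a + b * ω := by
      induction x using MonoidAlgebra.induction_linear with
      | zero => exact ⟨0, 0, by simp⟩
      | add x y hx hy =>
        obtain ⟨a, b, h1⟩ := hx
        obtain ⟨a', b', h2⟩ := hy
        exact ⟨a + a', b + b', by rw [map_add, h1, h2]; push_cast; ring⟩
      | single g r =>
        obtain ⟨a, b, h1⟩ := hroots (ψ.toHom g) (by rw [← map_pow, he, map_one])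
        exact ⟨r * a, r * b, by rw [lift_single, h1, zsmul_eq_mul]; push_cast; ring⟩
    obtain ⟨a, b, h⟩ := hmem
    have h2 : Complex.normSq (MonoidAlgebra.lift ℤ ℂ G ψ.toHom x) =
        ((a ^ 2 + t * a * b + b ^ 2 : ℤ) : ℝ) := by
      rw [h]
      rw [Complex.normSq_apply] at hω ⊢
      simp only [Complex.add_re, Complex.add_im, Complex.mul_re, Complex.mul_im,
        Complex.intCast_re, Complex.intCast_im]
      push_cast
      linear_combination (b : ℝ) ^ 2 * hω + a * b * hre
    have h3 : 0 ≤ a ^ 2 + t * a * b + b ^ 2 := by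
      have := Complex.normSq_nonneg (MonoidAlgebra.lift ℤ ℂ G ψ.toHom x)
      rw [h2] at this
      exact_mod_cast this
    exact ⟨(a ^ 2 + t * a * b + b ^ 2).toNat, by
      rw [h2]; exact_mod_cast (Int.toNat_of_nonneg h3).symm⟩
  have hone : ∀ ψ : AddChar (Additive G) ℂ,
      Complex.normSq (MonoidAlgebra.lift ℤ ℂ G ψ.toHom (u : IntGroupRing G)) = 1 := by
    intro ψ
    obtain ⟨m, hm⟩ := hint ψ u
    obtain ⟨k, hk⟩ := hint ψ (u⁻¹ : (IntGroupRing G)ˣ)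
    -- The norms of u and of its inverse are natural numbers with product 1.
    have hmk : m * k = 1 := by
      have h1 : (m * k : ℝ) = 1 := by
        rw [← hm, ← hk, ← map_mul, ← map_mul, Units.mul_inv, map_one, map_one]
      exact_mod_cast h1
    rw [hm, Nat.eq_one_of_mul_eq_one_right hmk, Nat.cast_one]
  have hsum := sum_normSq_lift (u : IntGroupRing G)
  simp_rw [hone] at hsum
  rw [Finset.sum_const, Finset.card_univ, AddChar.card_eq, nsmul_one] at hsum
  have hcard : (Fintype.card (Additive G) : ℝ) = Fintype.card G := by
    rw [Fintype.card_congr Additive.toMul]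
  rw [hcard] at hsum
  have hpos : (Fintype.card G : ℝ) ≠ 0 := by exact_mod_cast Fintype.card_ne_zero
  apply exists_eq_of_sum_sq_eq_one
  have := mul_left_cancel₀ hpos ((mul_one _).trans hsum)
  exact_mod_cast this.symm

theorem hasTrivialUnits_of_pow_four {G : Type*} [CommGroup G] [Finite G]
    (h : ∀ g : G, g ^ 4 = 1) : HasTrivialUnits G := by
  refine hasTrivialUnits_of_roots h (ω := Complex.I) (t := 0) (by simp) (by simp) ?_
  intro z hz
  have h1 : (z - 1) * ((z + 1) * ((z - Complex.I) * (z + Complex.I))) = 0 := by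
    linear_combination hz - (z ^ 2 - 1) * Complex.I_sq
  rcases mul_eq_zero.1 h1 with h | h
  · exact ⟨1, 0, by push_cast; linear_combination h⟩
  rcases mul_eq_zero.1 h with h | h
  · exact ⟨-1, 0, by push_cast; linear_combination h⟩
  rcases mul_eq_zero.1 h with h | h
  · exact ⟨0, 1, by push_cast; linear_combination h⟩
  · exact ⟨0, -1, by push_cast; linear_combination h⟩

theorem hasTrivialUnits_of_pow_six {G : Type*} [CommGroup G] [Finite G]
    (h : ∀ g : G, g ^ 6 = 1) : HasTrivialUnits G := by
  have h3 : √3 * √3 = (3 : ℝ) := Real.mul_self_sqrt (by norm_num)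
  let ω : ℂ := ⟨1 / 2, √3 / 2⟩
  have hω : ω ^ 2 - ω + 1 = 0 := by
    rw [pow_two]
    apply Complex.ext
    · simp [ω]; linarith
    · simp [ω]; ring
  refine hasTrivialUnits_of_roots h (ω := ω) (t := 1) (by simp [ω])
    (by simp [ω, Complex.normSq_apply]; linarith) ?_
  intro z hz
  have h1 : (z - 1) * ((z + 1) * ((z - ω) * ((z - (1 - ω)) * ((z + ω) * (z + (1 - ω)))))) = 0 := by
    have e1 : (z - ω) * (z - (1 - ω)) = z ^ 2 - z + 1 := by linear_combination -hω
    have e2 : (z + ω) * (z + (1 - ω)) = z ^ 2 + z + 1 := by linear_combination -hω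
    calc _ = (z - 1) * (z + 1) * (((z - ω) * (z - (1 - ω))) * ((z + ω) * (z + (1 - ω)))) := by ring
      _ = 0 := by rw [e1, e2]; linear_combination hz
  rcases mul_eq_zero.1 h1 with h | h
  · exact ⟨1, 0, by push_cast; linear_combination h⟩
  rcases mul_eq_zero.1 h with h | h
  · exact ⟨-1, 0, by push_cast; linear_combination h⟩
  rcases mul_eq_zero.1 h with h | h
  · exact ⟨0, 1, by push_cast; linear_combination h⟩
  rcases mul_eq_zero.1 h with h | h
  · exact ⟨1, -1, by push_cast; linear_combination h⟩
  rcases mul_eq_zero.1 h with h | h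
  · exact ⟨0, -1, by push_cast; linear_combination h⟩
  · exact ⟨-1, 1, by push_cast; linear_combination h⟩

theorem isCutGroup_iff_exponent {G : Type*} [CommGroup G] [Finite G] :
    IsCutGroup G ↔ Monoid.exponent G ∣ 4 ∨ Monoid.exponent G ∣ 6 := by
  constructor
  · intro h
    by_contra hcon
    push Not at hcon
    obtain ⟨g, hg⟩ := Monoid.exists_orderOf_eq_exponent (Monoid.ExponentExists.of_finite (G := G))
    rw [← hg] at hcon
    obtain ⟨u, -, hu⟩ := exists_normalizedUnit_not_isOfFinOrder (isOfFinOrder_of_finite g)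
      hcon.1 hcon.2
    apply hu
    -- Squaring removes the sign and leaves a group element.
    have hfin : IsOfFinOrder ((u : IntGroupRing G) ^ 2) := by
      obtain ⟨k, hk⟩ := h.hasTrivialUnits u
      have hk2 : (u : IntGroupRing G) ^ 2 = of ℤ G (k ^ 2) := by
        rcases hk with hk | hk <;> simp only [hk, map_pow, neg_sq]
      rw [hk2]
      exact (of ℤ G).isOfFinOrder (isOfFinOrder_of_finite _)
    rw [← Units.isOfFinOrder_val]
    exact hfin.of_pow two_ne_zero
  · rintro (h | h)
    · exact (hasTrivialUnits_of_pow_four fun g =>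
        Monoid.exponent_dvd_iff_forall_pow_eq_one.1 h g).isCutGroup
    · exact (hasTrivialUnits_of_pow_six fun g =>
        Monoid.exponent_dvd_iff_forall_pow_eq_one.1 h g).isCutGroup

end TrivialUnits

/-! ### Trivial units of the quaternion group of order 8. -/

section Quaternion

open scoped Quaternion

theorem pow_val_add {M : Type*} [Monoid M] {A : M} (hA : A ^ 4 = 1) (i j : ZMod (2 * 2)) :
    A ^ (i + j).val = A ^ i.val * A ^ j.val := by
  rw [ZMod.val_add, ← pow_add]
  exact (pow_eq_pow_mod _ hA).symm

/-- The homomorphism from the quaternion group of order `8` defined by the images of two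
generators. -/
def QuaternionGroup.liftTwo {M : Type*} [Monoid M] (A X : M) (hA : A ^ 4 = 1) (hX : X * X = A ^ 2)
    (hAX : A * X = X * A ^ 3) : QuaternionGroup 2 →* M where
  toFun
    | .a i => A ^ i.val
    | .xa i => X * A ^ i.val
  map_one' := by
    change A ^ (0 : ZMod (2 * 2)).val = 1
    simp
  map_mul' := by
    have hcomm : ∀ i : ZMod (2 * 2), A ^ i.val * X = X * A ^ (-i).val := by
      have hneg : ∀ n : ℕ, A ^ n * X = X * A ^ (3 * n) := by
        intro n
        induction n with
        | zero => simp
        | succ n ih =>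
          rw [pow_succ', mul_assoc, ih, ← mul_assoc, hAX, mul_assoc, ← pow_add]; ring_nf
      intro i
      rw [hneg, pow_eq_pow_mod _ hA]
      have : ∀ i : ZMod (2 * 2), 3 * i.val % 4 = (-i).val := by decide
      rw [this]
    rintro (i | i) (j | j)
    · exact pow_val_add hA i j
    · change X * A ^ (j - i).val = A ^ i.val * (X * A ^ j.val)
      rw [← mul_assoc, hcomm, mul_assoc, ← pow_val_add hA, neg_add_eq_sub]
    · change X * A ^ (i + j).val = X * A ^ i.val * A ^ j.val
      rw [pow_val_add hA, mul_assoc]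
    · change A ^ ((2 : ℕ) + j - i : ZMod (2 * 2)).val = X * A ^ i.val * (X * A ^ j.val)
      rw [mul_assoc, ← mul_assoc _ X, hcomm, ← mul_assoc, ← mul_assoc, hX, mul_assoc,
        ← pow_val_add hA, neg_add_eq_sub, add_sub_assoc, pow_val_add hA]
      rfl

theorem QuaternionGroup.sum_univ_two {A : Type*} [AddCommMonoid A] (f : QuaternionGroup 2 → A) :
    ∑ g, f g = f (.a 0) + f (.a 1) + f (.a 2) + f (.a 3) +
      (f (.xa 0) + f (.xa 1) + f (.xa 2) + f (.xa 3)) := by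
  have h : (Finset.univ : Finset (QuaternionGroup 2)) =
      {.a 0, .a 1, .a 2, .a 3, .xa 0, .xa 1, .xa 2, .xa 3} := by decide
  rw [h]
  repeat rw [Finset.sum_insert (by decide)]
  rw [Finset.sum_singleton]
  simp only [add_assoc]

/-- Parseval for K₈: 8 ∑ x_g² is the sum of the squares of the four linear characters at x plus 4
times the quaternion norm. At a unit this is 4 + 4. -/
theorem hasTrivialUnits_quaternionGroup : HasTrivialUnits (QuaternionGroup 2) := by
  intro u
  have hint : ∀ φ : IntGroupRing (QuaternionGroup 2) →ₐ[ℤ] ℤ, φ u ^ 2 = 1 := by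
    intro φ
    rw [sq_eq_one_iff]
    exact Int.isUnit_iff.1 (u.isUnit.map φ)
  have hquat : ∀ φ : IntGroupRing (QuaternionGroup 2) →ₐ[ℤ] ℍ[ℤ],
      Quaternion.normSq (φ u) = 1 := by
    intro φ
    have h := Int.isUnit_iff.1 ((u.isUnit.map φ).map Quaternion.normSq)
    refine h.resolve_right fun h' => ?_
    have := Quaternion.normSq_nonneg (a := φ u)
    omega
  have h1 := hint (MonoidAlgebra.lift ℤ ℤ _
    (QuaternionGroup.liftTwo 1 1 (by simp) (by simp) (by simp)))
  have h2 := hint (MonoidAlgebra.lift ℤ ℤ _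
    (QuaternionGroup.liftTwo (-1) 1 (by simp) (by simp) (by simp)))
  have h3 := hint (MonoidAlgebra.lift ℤ ℤ _
    (QuaternionGroup.liftTwo 1 (-1) (by simp) (by simp) (by simp)))
  have h4 := hint (MonoidAlgebra.lift ℤ ℤ _
    (QuaternionGroup.liftTwo (-1) (-1) (by simp) (by simp) (by simp)))
  let I : ℍ[ℤ] := ⟨0, 1, 0, 0⟩
  let J : ℍ[ℤ] := ⟨0, 0, 1, 0⟩
  have hI2 : I ^ 2 = -1 := by rw [pow_two]; rfl
  have hI3 : I ^ 3 = -I := by rw [pow_succ, hI2, neg_one_mul]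
  have hI4 : I ^ 4 = 1 := by rw [pow_succ, hI3]; rfl
  have hJ : J * J = I ^ 2 := by rw [hI2]; rfl
  have hIJ : I * J = J * I ^ 3 := by rw [hI3]; rfl
  have h5 := hquat (MonoidAlgebra.lift ℤ ℍ[ℤ] _ (QuaternionGroup.liftTwo I J hI4 hJ hIJ))
  rw [lift_eq_sum, QuaternionGroup.sum_univ_two] at h1 h2 h3 h4 h5
  apply exists_eq_of_sum_sq_eq_one
  rw [QuaternionGroup.sum_univ_two]
  have v0 : (0 : ZMod (2 * 2)).val = 0 := rfl
  have v1 : (1 : ZMod (2 * 2)).val = 1 := rfl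
  have v2 : (2 : ZMod (2 * 2)).val = 2 := rfl
  have v3 : (3 : ZMod (2 * 2)).val = 3 := rfl
  let K : ℍ[ℤ] := ⟨0, 0, 0, -1⟩
  have hJI : J * I = K := rfl
  have reI : I.re = 0 ∧ I.imI = 1 ∧ I.imJ = 0 ∧ I.imK = 0 := ⟨rfl, rfl, rfl, rfl⟩
  have reJ : J.re = 0 ∧ J.imI = 0 ∧ J.imJ = 1 ∧ J.imK = 0 := ⟨rfl, rfl, rfl, rfl⟩
  have reK : K.re = 0 ∧ K.imI = 0 ∧ K.imJ = 0 ∧ K.imK = -1 := ⟨rfl, rfl, rfl, rfl⟩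
  simp only [QuaternionGroup.liftTwo, MonoidHom.coe_mk, OneHom.coe_mk, v0, v1, v2, v3, hI2, hI3,
    mul_neg, hJI, pow_zero, pow_one, mul_one, one_pow] at h1 h2 h3 h4 h5
  generalize (u : IntGroupRing (QuaternionGroup 2)).coeff = x at *
  generalize x (.a 0) = x0, x (.a 1) = x1, x (.a 2) = x2, x (.a 3) = x3, x (.xa 0) = y0,
    x (.xa 1) = y1, x (.xa 2) = y2, x (.xa 3) = y3 at *
  clear_value I J K
  rw [Quaternion.normSq_def'] at h5
  simp [reI, reJ, reK] at h5
  simp only [Int.cast_id] at h1 h2 h3 h4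
  linarith

end Quaternion

/-! ### Direct products with elementary abelian 2-groups. -/

section Product

theorem exists_int_character {E : Type*} [Group E] (hE : ∀ e : E, e ^ 2 = 1)
    (χ : E →* ℂ) : ∃ s : E →* ℤ, ∀ e, (s e : ℂ) = χ e := by
  have h : ∀ e, ∃ m : ℤ, (m : ℂ) = χ e := by
    intro e
    have h1 : χ e ^ 2 = 1 := by rw [← map_pow, hE, map_one]
    rcases sq_eq_one_iff.1 h1 with h | h
    · exact ⟨1, by simp [h]⟩
    · exact ⟨-1, by simp [h]⟩
  choose s hs using h
  refine ⟨⟨⟨s, ?_⟩, ?_⟩, hs⟩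
  · apply Int.cast_injective (α := ℂ)
    rw [hs, map_one, Int.cast_one]
  · intro a b
    apply Int.cast_injective (α := ℂ)
    change ((s (a * b) : ℤ) : ℂ) = ((s a * s b : ℤ) : ℂ)
    rw [hs, map_mul, Int.cast_mul, hs, hs]

theorem sum_sq_coeff_of_or_neg {H : Type*} [Group H] [Fintype H] {x : IntGroupRing H}
    (hx : ∃ h : H, x = of ℤ H h ∨ x = -of ℤ H h) : ∑ h, x.coeff h ^ 2 = 1 := by
  classical
  obtain ⟨h, rfl | rfl⟩ := hx <;> simp [Finsupp.single_apply]

/-- Characters of E take values ±1, so each induces a ring map ℤ[H × E] → ℤH carrying u to a trivial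
unit. Parseval over E, applied to each slice {h} × E, then gives ∑ (coefficients)² = 1. -/
theorem HasTrivialUnits.prod {H E : Type*} [Group H] [Finite H] [CommGroup E] [Finite E]
    (hH : HasTrivialUnits H) (hE : ∀ e : E, e ^ 2 = 1) : HasTrivialUnits (H × E) := by
  classical
  have := Fintype.ofFinite H
  have := Fintype.ofFinite E
  intro u
  apply exists_eq_of_sum_sq_eq_one
  let x : H → IntGroupRing E := fun h =>
    ofCoeff (Finsupp.equivFunOnFinite.symm fun e => (u : IntGroupRing (H × E)).coeff (h, e))
  have hslice : ∀ ψ : AddChar (Additive E) ℂ,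
      ∑ h, Complex.normSq (MonoidAlgebra.lift ℤ ℂ E ψ.toHom (x h)) = 1 := by
    intro ψ
    obtain ⟨s, hs⟩ := exists_int_character hE ψ.toHom
    let f : H × E →* IntGroupRing H :=
      { toFun := fun p => single p.1 (s p.2)
        map_one' := by simp [one_def]
        map_mul' := fun p q => by simp [single_mul_single] }
    have hcoeff : ∀ h, (((MonoidAlgebra.lift ℤ _ _ f u).coeff h : ℤ) : ℂ) =
        MonoidAlgebra.lift ℤ ℂ E ψ.toHom (x h) := by
      intro h
      rw [lift_eq_sum, lift_eq_sum, coeff_sum, Finsupp.finsetSum_apply, Fintype.sum_prod_type,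
        Finset.sum_eq_single h]
      · push_cast
        refine Finset.sum_congr rfl fun e _ => ?_
        rw [← hs, ← zsmul_eq_mul, coeff_smul_apply]
        simp [f, x]
      · intro k _ hk
        refine Finset.sum_eq_zero fun e _ => ?_
        rw [← zsmul_eq_mul, coeff_smul_apply]
        simp [f, Finsupp.single_eq_of_ne hk.symm]
      · simp
    have h1 := sum_sq_coeff_of_or_neg
      (hH (Units.map (MonoidAlgebra.lift ℤ _ _ f).toRingHom.toMonoidHom u))
    simp_rw [← hcoeff, Complex.normSq_intCast, ← pow_two]
    exact_mod_cast h1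
  have hsum : ∑ ψ : AddChar (Additive E) ℂ,
      ∑ h, Complex.normSq (MonoidAlgebra.lift ℤ ℂ E ψ.toHom (x h)) =
        Fintype.card E * ∑ h, ∑ e, ((x h).coeff e : ℝ) ^ 2 := by
    rw [Finset.sum_comm, Finset.mul_sum]
    exact Finset.sum_congr rfl fun h _ => sum_normSq_lift (x h)
  simp_rw [hslice] at hsum
  rw [Finset.sum_const, Finset.card_univ, AddChar.card_eq, nsmul_one,
    Fintype.card_congr Additive.toMul] at hsum
  have hpos : (Fintype.card E : ℝ) ≠ 0 := by exact_mod_cast Fintype.card_ne_zero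
  have := mul_left_cancel₀ hpos ((mul_one _).trans hsum)
  rw [Fintype.sum_prod_type]
  exact_mod_cast this.symm

end Product

/-! ### Separating group elements from 1 modulo Δ² and Δ³. -/

section DimensionSubgroups

variable {G : Type*} [Group G]

/-- The additive extension of a function on `G` to the group ring. -/
noncomputable def linearExtension {A : Type*} [AddCommGroup A] (f : G → A) :
    IntGroupRing G →+ A :=
  (Finsupp.liftAddHom fun g => (zmultiplesHom A (f g))).comp
    (coeffAddEquiv (R := ℤ) (M := G)).toAddMonoidHom

theorem linearExtension_single {A : Type*} [AddCommGroup A] (f : G → A) (g : G) (r : ℤ) :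
    linearExtension f (single g r) = r • f g := by
  simp [linearExtension]

theorem linearExtension_of_sub_one {A : Type*} [AddCommGroup A] (f : G → A) (g : G) :
    linearExtension f (of ℤ G g - 1) = f g - f 1 := by
  rw [map_sub, one_def, linearExtension_single, one_smul]
  exact congrArg (· - f 1) ((linearExtension_single f g 1).trans (one_smul _ _))

/-- On Δ × Δ only the bilinear term survives; for additive α it vanishes once x lies in Δ². -/
theorem linearExtension_mul {A B : Type*} [AddCommGroup A] [AddCommGroup B] (f : G → B)
    (α β : G → A) (φ : A →+ A →+ B) (hf : ∀ g h, f (g * h) = f g + f h + φ (α g) (β h))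
    (x y : IntGroupRing G) :
    linearExtension f (x * y) = augmentation G x • linearExtension f y +
      augmentation G y • linearExtension f x +
        φ (linearExtension α x) (linearExtension β y) := by
  induction x using MonoidAlgebra.induction_linear with
  | zero => simp
  | add x x' hx hx' =>
    rw [add_mul, map_add, hx, hx']
    simp only [map_add, add_smul, smul_add, AddMonoidHom.add_apply]
    abel
  | single g r =>
    induction y using MonoidAlgebra.induction_linear with
    | zero => simp
    | add y y' hy hy' =>
      rw [mul_add, map_add, hy, hy']
      simp only [map_add, add_smul, smul_add]
      abel
    | single h s =>
      simp only [single_mul_single, linearExtension_single, augmentation_single, hf, map_zsmul,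
        AddMonoidHom.zsmul_apply, smul_add, smul_smul]
      rw [mul_comm s r]
      abel

theorem linearExtension_eq_zero_of_mem_sq {A : Type*} [AddCommGroup A] {f : G → A}
    (hf : ∀ g h, f (g * h) = f g + f h) {x : IntGroupRing G} (hx : x ∈ augIdeal G ^ 2) :
    linearExtension f x = 0 := by
  rw [Submodule.pow_succ, Submodule.pow_one] at hx
  induction hx using Submodule.mul_induction_on' with
  | mem_mul_mem a ha b hb =>
    rw [linearExtension_mul f f f 0 (by simpa using hf), mem_augIdeal.1 ha, mem_augIdeal.1 hb]
    simp
  | add a _ b _ ha hb => rw [map_add, ha, hb, add_zero]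

theorem linearExtension_eq_zero_of_mem_cube {A B : Type*} [AddCommGroup A] [AddCommGroup B]
    {f : G → B} {α β : G → A} {φ : A →+ A →+ B} (hα : ∀ g h, α (g * h) = α g + α h)
    (hf : ∀ g h, f (g * h) = f g + f h + φ (α g) (β h)) {x : IntGroupRing G}
    (hx : x ∈ augIdeal G ^ 3) : linearExtension f x = 0 := by
  rw [Submodule.pow_succ] at hx
  induction hx using Submodule.mul_induction_on' with
  | mem_mul_mem a ha b hb =>
    have ha0 : augmentation G a = 0 := mem_augIdeal.1 (Ideal.pow_le_self two_ne_zero ha)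
    rw [linearExtension_mul f α β φ hf, ha0, mem_augIdeal.1 hb,
      linearExtension_eq_zero_of_mem_sq hα ha]
    simp
  | add a _ b _ ha hb => rw [map_add, ha, hb, add_zero]

theorem eq_one_of_sub_one_mem_sq {G : Type*} [CommGroup G] {g : G}
    (hg : of ℤ G g - 1 ∈ augIdeal G ^ 2) : g = 1 := by
  have := linearExtension_eq_zero_of_mem_sq (f := (Additive.ofMul : G → Additive G))
    (fun _ _ => rfl) hg
  rw [linearExtension_of_sub_one, sub_eq_zero] at this
  exact Additive.ofMul.injective this

/-- K₈ is a central extension of (ℤ/2)² by ℤ/2 with the bilinear cocycle φ(α, β). Here α is the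
projection, which kills just 1 and `a 2`, and f is the ℤ/2-coordinate, which tells these two apart.
-/
theorem QuaternionGroup.eq_one_of_sub_one_mem_cube {g : QuaternionGroup 2}
    (hg : of ℤ (QuaternionGroup 2) g - 1 ∈ augIdeal (QuaternionGroup 2) ^ 3) : g = 1 := by
  let α : QuaternionGroup 2 → ZMod 2 × ZMod 2
    | .a i => (i.val, 0)
    | .xa i => (i.val, 1)
  let β : QuaternionGroup 2 → ZMod 2 × ZMod 2
    | .a i => (i.val, 0)
    | .xa i => (i.val + 1, 1)
  let f : QuaternionGroup 2 → ZMod 2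
    | .a i => if 2 ≤ i.val then 1 else 0
    | .xa i => if 2 ≤ i.val then 1 else 0
  let φ : ZMod 2 × ZMod 2 →+ ZMod 2 × ZMod 2 →+ ZMod 2 :=
    AddMonoidHom.mk' (fun p => AddMonoidHom.mk' (fun q => p.1 * q.1 + p.2 * q.2)
      fun q q' => by simp only [Prod.fst_add, Prod.snd_add]; ring)
      fun p p' => AddMonoidHom.ext fun q => by
        simp only [AddMonoidHom.mk'_apply, AddMonoidHom.add_apply, Prod.fst_add, Prod.snd_add]; ring
  have hα : ∀ g h, α (g * h) = α g + α h := by decide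
  have hf : ∀ g h, f (g * h) = f g + f h + φ (α g) (β h) := by decide
  have h1 := linearExtension_eq_zero_of_mem_cube hα hf hg
  have h2 := linearExtension_eq_zero_of_mem_sq hα
    ((Ideal.pow_le_pow_right (by norm_num : 2 ≤ 3)) hg)
  rw [linearExtension_of_sub_one, sub_eq_zero] at h1 h2
  have key : ∀ g, f g = f 1 → α g = α 1 → g = 1 := by decide
  exact key g h1 h2

theorem HasTrivialUnits.unitFiltration_eq_bot (h : HasTrivialUnits G) {n : ℕ}
    (hn : ∀ g : G, of ℤ G g - 1 ∈ augIdeal G ^ n → g = 1) : unitFiltration G n = ⊥ := by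
  rw [eq_bot_iff]
  intro u hu
  rw [mem_unitFiltration] at hu
  obtain ⟨g, hg | hg⟩ := h u
  · rw [hg] at hu
    rw [Subgroup.mem_bot]
    ext1
    rw [hg, hn g hu.2, map_one, Units.val_one]
  · rw [hg, map_neg, augmentation_of] at hu
    norm_num at hu

theorem unitFiltration_two_eq_bot {G : Type*} [CommGroup G] (h : IsCutGroup G) :
    unitFiltration G 2 = ⊥ :=
  h.hasTrivialUnits.unitFiltration_eq_bot fun _ => eq_one_of_sub_one_mem_sq

theorem of_map_sub_one_mem {K : Type*} [Group K] (f : G →* K) {g : G} {n : ℕ}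
    (hg : of ℤ G g - 1 ∈ augIdeal G ^ n) : of ℤ K (f g) - 1 ∈ augIdeal K ^ n := by
  have h := mapDomain_mem_augIdeal_pow f hg
  have h1 : mapDomainRingHom ℤ f (of ℤ G g) = of ℤ K (f g) := by simp
  rwa [map_sub, map_one, h1] at h

theorem unitFiltration_three_eq_bot {E : Type*} [CommGroup E] (hE : ∀ e : E, e ^ 2 = 1)
    [Finite G] (e : G ≃* QuaternionGroup 2 × E) : unitFiltration G 3 = ⊥ := by
  have : Finite E := Finite.of_surjective (fun g => (e g).2)
    (Prod.snd_surjective.comp e.surjective)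
  refine ((hasTrivialUnits_quaternionGroup.prod hE).of_mulEquiv e).unitFiltration_eq_bot ?_
  intro g hg
  have h1 := QuaternionGroup.eq_one_of_sub_one_mem_cube
    (of_map_sub_one_mem ((MonoidHom.fst _ _).comp e.toMonoidHom) hg)
  have h2 := eq_one_of_sub_one_mem_sq (Ideal.pow_le_pow_right (by norm_num : 2 ≤ 3)
    (of_map_sub_one_mem ((MonoidHom.snd _ _).comp e.toMonoidHom) hg))
  exact e.map_eq_one_iff.1 (Prod.ext h1 h2)

end DimensionSubgroups

/-! ### Bicyclic units and normality of cyclic subgroups. -/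

section Bicyclic

/-- If all normalized units of `ℤG` have finite order, then every cyclic subgroup of `G` is
normal: otherwise a bicyclic unit has infinite order. -/
theorem exists_mul_eq_mul_pow {G : Type*} [Group G] [Finite G]
    (htors : ∀ u ∈ normalizedUnits G, IsOfFinOrder u) (g h : G) : ∃ i : ℕ, g * h = h * g ^ i := by
  classical
  set N : IntGroupRing G := ∑ i ∈ Finset.range (orderOf g), of ℤ G g ^ i with hN
  have hN0 : N * (of ℤ G g - 1) = 0 := by
    rw [hN, geom_sum_mul, ← map_pow, pow_orderOf_eq_one, map_one, sub_self]
  -- As N(g - 1) = 0, x has square zero and (1 + x)^m = 1 + mx. Torsion therefore forces x = 0, that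
  -- is, ghN = hN.
  set x : IntGroupRing G := (of ℤ G g - 1) * of ℤ G h * N with hx
  have hxx : x * x = 0 := by
    calc x * x = (of ℤ G g - 1) * of ℤ G h * (N * (of ℤ G g - 1)) * of ℤ G h * N := by
          simp only [hx, mul_assoc]
      _ = 0 := by rw [hN0]; simp
  let u : (IntGroupRing G)ˣ := ⟨1 + x, 1 - x, by
    rw [mul_sub, add_mul, add_mul, hxx]; simp, by
    rw [sub_mul, mul_add, mul_add, hxx]; simp⟩
  have hu : u ∈ normalizedUnits G := by
    rw [mem_normalizedUnits]
    simp [u, hx, augmentation_single]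
  obtain ⟨k, hk, hpow⟩ := (htors u hu).exists_pow_eq_one
  have hpow' : ∀ m : ℕ, (1 + x) ^ m = 1 + m • x := by
    intro m
    induction m with
    | zero => simp
    | succ m ih =>
      rw [pow_succ, ih, mul_add, mul_one, add_mul, smul_mul_assoc, hxx, add_smul, one_smul,
        smul_zero, add_zero, one_mul, add_assoc]
  have hkx : k • x = 0 := by
    have h1 := congrArg Units.val hpow
    rw [Units.val_pow_eq_pow_val, Units.val_one] at h1
    have h2 : (1 + x) ^ k = 1 := h1
    rwa [hpow', add_eq_left] at h2
  have hx0 : x = 0 := by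
    ext a
    have h1 := congrArg (fun y : IntGroupRing G => y.coeff a) hkx
    rw [coeff_smul_apply] at h1
    exact (smul_eq_zero.1 h1).resolve_left hk.ne'
  have hsum : ∑ i ∈ Finset.range (orderOf g), of ℤ G (g * h * g ^ i) =
      ∑ i ∈ Finset.range (orderOf g), of ℤ G (h * g ^ i) := by
    rw [hx, mul_assoc, sub_mul, one_mul, sub_eq_zero, ← mul_assoc, hN, Finset.mul_sum,
      Finset.mul_sum] at hx0
    simpa only [map_mul, map_pow] using hx0
  have hcoeff := congrArg (fun y : IntGroupRing G => y.coeff (g * h)) hsum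
  simp only [coeff_sum, Finsupp.finsetSum_apply, of_apply, coeff_single,
    Finsupp.single_apply] at hcoeff
  -- The term i = 0 puts gh in the support of ghN, hence in that of hN.
  have hpos : 0 < ∑ i ∈ Finset.range (orderOf g),
      if g * h * g ^ i = g * h then (1 : ℤ) else 0 := by
    apply Finset.sum_pos' (fun i _ => by split_ifs <;> norm_num)
    exact ⟨0, Finset.mem_range.2 (orderOf_pos g), by simp⟩
  rw [hcoeff] at hpos
  obtain ⟨i, -, hi⟩ := Finset.exists_ne_zero_of_sum_ne_zero hpos.ne'
  refine ⟨i, ?_⟩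
  by_contra hne
  exact hi (if_neg fun h' => hne h'.symm)

end Bicyclic

/-! ### Groups in which noncommuting elements invert each other. -/

section Hamiltonian

/-- Conjugation preserves order, so i is prime to the order n of x; for n dividing 4 or 6 the only
units modulo n are ±1. -/
theorem eq_or_eq_inv_of_conj {G : Type*} [Group G] [Finite G] {x y : G} {i : ℕ}
    (hord : orderOf x ∣ 4 ∨ orderOf x ∣ 6) (h : x * y = y * x ^ i) :
    x ^ i = x ∨ x ^ i = x⁻¹ := by
  have hconj : x ^ i = y⁻¹ * x * y := by rw [mul_assoc, h, inv_mul_cancel_left]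
  have ho : orderOf (x ^ i) = orderOf x := by
    rw [hconj]
    simpa using orderOf_injective (MulAut.conj y⁻¹).toMonoidHom (MulAut.conj y⁻¹).injective x
  rw [orderOf_pow] at ho
  have hpos := orderOf_pos x
  have hgcd : Nat.gcd (orderOf x) i = 1 := by
    have h1 := Nat.div_mul_cancel (Nat.gcd_dvd_left (orderOf x) i)
    rw [ho] at h1
    exact Nat.eq_of_mul_eq_mul_left hpos (by rw [h1, mul_one])
  rw [← pow_mod_orderOf]
  rw [← Nat.mod_add_div i (orderOf x), Nat.gcd_add_mul_left_right] at hgcd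
  have hj := Nat.mod_lt i hpos
  generalize i % orderOf x = j at *
  have hcases : j = 1 ∨ j + 1 = orderOf x := by
    have h6 : orderOf x ≤ 6 := by
      rcases hord with h | h
      · exact (Nat.le_of_dvd (by norm_num) h).trans (by norm_num)
      · exact Nat.le_of_dvd (by norm_num) h
    generalize orderOf x = n at *
    interval_cases n <;> interval_cases j <;> simp_all
  rcases hcases with rfl | h'
  · left; rw [pow_one]
  · right
    rw [eq_inv_iff_mul_eq_one, ← pow_succ, h', pow_orderOf_eq_one]

variable {G : Type*} [Group G]

/-- Two elements that invert each other by conjugation generate a quotient of the quaternion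
group. -/
theorem quaternion_relations_of_inverting {x y : G} (hxy : x * y = y * x⁻¹)
    (hyx : y * x = x * y⁻¹) : x ^ 4 = 1 ∧ y * y = x ^ 2 := by
  have h1 : y * y = x⁻¹ * x⁻¹ := by
    have : x * y = x * y⁻¹ * x⁻¹ * x⁻¹ := by
      rw [← hyx, mul_inv_cancel_right, hxy]
    rw [mul_assoc, mul_assoc, mul_right_inj] at this
    rw [eq_inv_mul_iff_mul_eq] at this
    exact this
  have h2 : x * x * y = y * (x⁻¹ * x⁻¹) := by
    rw [mul_assoc, hxy, ← mul_assoc, hxy, mul_assoc]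
  have h3 : x * x * y = y * (x * x) := by
    have h4 : x * x = (y * y)⁻¹ := by rw [h1, mul_inv_rev, inv_inv]
    rw [h4]; group
  have h5 : x * x = x⁻¹ * x⁻¹ := by
    rw [h3] at h2; exact mul_left_cancel h2
  refine ⟨?_, by rw [h1, ← h5, pow_two]⟩
  calc x ^ 4 = x * x * (x * x) := by simp only [pow_succ, pow_zero, one_mul, mul_assoc]
    _ = x * x * (x⁻¹ * x⁻¹) := by rw [← h5]
    _ = 1 := by group

theorem mul_self_eq_of_not_commute
    (hinv : ∀ x y : G, x * y ≠ y * x → x * y = y * x⁻¹)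
    {x y : G} (hxy : x * y ≠ y * x) :
    x ^ 4 = 1 ∧ y * y = x ^ 2 :=
  quaternion_relations_of_inverting (hinv x y hxy) (hinv y x hxy.symm)

theorem sq_ne_one_of_not_commute
    (hinv : ∀ x y : G, x * y ≠ y * x → x * y = y * x⁻¹)
    {x y : G} (hxy : x * y ≠ y * x) : x ^ 2 ≠ 1 := by
  intro h
  apply hxy
  rw [pow_two, mul_eq_one_iff_eq_inv] at h
  rw [hinv x y hxy, ← h]

/-- Neither x nor cx commutes with y, so (cx)² = y² = x². -/
theorem sq_eq_one_of_mem_centralizer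
    (hinv : ∀ x y : G, x * y ≠ y * x → x * y = y * x⁻¹)
    {x y c : G} (hxy : x * y ≠ y * x) (hcx : c * x = x * c)
    (hcy : c * y = y * c) : c ^ 2 = 1 := by
  have hne : c * x * y ≠ y * (c * x) := by
    rw [← mul_assoc, ← hcy, mul_assoc, mul_assoc]
    exact fun h => hxy (mul_left_cancel h)
  have h1 := (mul_self_eq_of_not_commute hinv hne).2
  have h2 := (mul_self_eq_of_not_commute hinv hxy).2
  rw [h2, (show Commute c x from hcx).mul_pow] at h1
  exact (right_eq_mul.1 h1)

/-- Each g centralizes or inverts x, and likewise y. Right multiplication by y⁻¹ corrects the action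
on x; then x⁻¹, if needed, corrects the action on y. -/
theorem exists_mem_centralizer_mul
    (hinv : ∀ x y : G, x * y ≠ y * x → x * y = y * x⁻¹)
    {x y : G} (hxy : x * y ≠ y * x)
    (ρ : QuaternionGroup 2 →* G) (hx : ρ (.a 1) = x) (hy : ρ (.xa 0) = y) (g : G) :
    ∃ (q : QuaternionGroup 2) (c : G), c * x = x * c ∧ c * y = y * c ∧ g = c * ρ q := by
  have e1 := hinv x y hxy
  have e2 := hinv y x hxy.symm
  have f1 : x⁻¹ * y⁻¹ = y⁻¹ * x := by
    rw [eq_inv_mul_iff_mul_eq, ← mul_assoc, ← e1, mul_inv_cancel_right]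
  have f2 : y⁻¹ * x⁻¹ = x⁻¹ * y := by
    rw [eq_inv_mul_iff_mul_eq, ← mul_assoc, ← e2, mul_inv_cancel_right]
  have hcomm : ∀ g, x * g = g * x → ∃ (q : QuaternionGroup 2) (c : G),
      c * x = x * c ∧ c * y = y * c ∧ g = c * ρ q := by
    intro g gx
    by_cases gy : y * g = g * y
    · exact ⟨1, g, gx.symm, gy.symm, by simp⟩
    · refine ⟨.a 1, g * x⁻¹, ?_, ?_, by simp [hx]⟩
      · rw [← mul_assoc, gx]; group
      · rw [← mul_assoc, hinv y g gy, mul_assoc, mul_assoc, f2]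
  by_cases gx : x * g = g * x
  · exact hcomm g gx
  · obtain ⟨q, c, h1, h2, h3⟩ := hcomm (g * y⁻¹) (by
      rw [← mul_assoc, hinv x g gx, mul_assoc, mul_assoc, f1])
    exact ⟨q * .xa 0, c, h1, h2, by rw [map_mul, hy, ← mul_assoc, ← h3, inv_mul_cancel_right]⟩

/-- A finite nonabelian group in which noncommuting elements invert each other is the direct
product of the quaternion group of order `8` and an elementary abelian `2`-group. -/
theorem exists_mulEquiv_quaternionGroup_prod {G : Type u} [Group G] [Finite G]
    (hinv : ∀ x y : G, x * y ≠ y * x → x * y = y * x⁻¹) {x y : G} (hxy : x * y ≠ y * x) :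
    ∃ (E : Type u) (_ : CommGroup E), (∀ e : E, e ^ 2 = 1) ∧
      Nonempty (G ≃* QuaternionGroup 2 × E) := by
  classical
  obtain ⟨hx4, hyy⟩ := mul_self_eq_of_not_commute hinv hxy
  have hx2 := sq_ne_one_of_not_commute hinv hxy
  have hx3 : x ^ 3 = x⁻¹ := by rw [eq_inv_iff_mul_eq_one, ← pow_succ, hx4]
  let ρ : QuaternionGroup 2 →* G :=
    QuaternionGroup.liftTwo x y hx4 hyy (by rw [hx3]; exact hinv x y hxy)
  have hρa : ∀ i, ρ (.a i) = x ^ i.val := fun _ => rfl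
  have hρxa : ∀ i, ρ (.xa i) = y * x ^ i.val := fun _ => rfl
  have hρ1 : ρ (.a 1) = x := pow_one x
  have hρy : ρ (.xa 0) = y := by rw [hρxa, ZMod.val_zero, pow_zero, mul_one]
  have hρz : ρ (.a 2) = x ^ 2 := rfl
  have hρc : ∀ q, ρ q * x = x * ρ q → ρ q * y = y * ρ q → q = 1 ∨ q = .a 2 := by
    have hodd : ∀ i : ZMod (2 * 2), i = 0 ∨ i = 2 ∨ x ^ i.val = x ∨ x ^ i.val = x⁻¹ := by
      intro i
      fin_cases i
      · exact Or.inl rfl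
      · exact Or.inr (Or.inr (Or.inl (pow_one x)))
      · exact Or.inr (Or.inl rfl)
      · exact Or.inr (Or.inr (Or.inr hx3))
    rintro (i | i) h1 h2
    · rw [hρa] at h2
      rcases hodd i with rfl | rfl | h | h
      · exact Or.inl rfl
      · exact Or.inr rfl
      · rw [h] at h2; exact absurd h2 hxy
      · rw [h] at h2
        exact absurd (Commute.inv_left_iff.1 h2).eq hxy
    · rw [hρxa] at h1
      refine absurd ?_ hxy
      rw [mul_assoc, (Commute.pow_self x i.val).eq, ← mul_assoc, ← mul_assoc] at h1
      exact (mul_right_cancel h1).symm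
  let C : Subgroup G := Subgroup.centralizer {x, y}
  have hC : ∀ c : G, c ∈ C ↔ c * x = x * c ∧ c * y = y * c := by
    intro c
    simp [C, Subgroup.mem_centralizer_iff, eq_comm (b := c * _)]
  have hC2 : ∀ c : C, c ^ 2 = 1 := by
    intro c
    have := (hC c).1 c.2
    exact Subtype.ext (sq_eq_one_of_mem_centralizer hinv hxy this.1 this.2)
  let : CommGroup C :=
    { (inferInstance : Group C) with
      mul_comm := fun a b =>
        (Commute.of_orderOf_dvd_two (fun c : C => orderOf_dvd_of_pow_eq_one (hC2 c)) a b).eq }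
  have hzC : x ^ 2 ∈ C := by
    rw [hC]
    refine ⟨(Commute.pow_self x 2).eq, ?_⟩
    rw [← hyy, mul_assoc]
  let z : C := ⟨x ^ 2, hzC⟩
  -- The centralizer C meets the image of K₈ in ⟨z⟩. A character of C nontrivial at z has values ±1,
  -- so its kernel E complements ⟨z⟩ in C.
  obtain ⟨ψ, hψ⟩ := (AddChar.exists_apply_ne_zero (a := Additive.ofMul z)).2 (by
    intro h
    exact hx2 (congrArg Subtype.val (Additive.ofMul.injective h)))
  let E : Subgroup C := ψ.toHom.ker
  have hE : ∀ c : C, c ∈ E ↔ ψ (Additive.ofMul c) = 1 := fun c => MonoidHom.mem_ker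
  have hsign : ∀ c : C, c ∉ E → ψ (Additive.ofMul c) = -1 := by
    intro c hc
    have h1 : ψ.toHom c ^ 2 = 1 := by rw [← map_pow, hC2, map_one]
    exact (sq_eq_one_iff.1 h1).resolve_left hc
  have hzE : z ∉ E := hψ
  have hsplit : ∀ c : C, c ∈ E ∨ z * c ∈ E := by
    intro c
    by_cases hc : c ∈ E
    · exact Or.inl hc
    · right
      rw [hE, ofMul_mul, AddChar.map_add_eq_mul, hsign c hc, hsign z hzE]
      norm_num
  let ι : E →* G := C.subtype.comp E.subtype
  have hιC : ∀ e : E, ι e * x = x * ι e ∧ ι e * y = y * ι e := fun e => (hC _).1 e.1.2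
  have hcomm : ∀ q (e : E), Commute (ρ q) (ι e) := by
    intro q e
    have hx' : Commute x (ι e) := (hιC e).1.symm
    have hy' : Commute y (ι e) := (hιC e).2.symm
    rcases q with i | i
    · exact hx'.pow_left _
    · exact hy'.mul_left (hx'.pow_left _)
  let Φ : QuaternionGroup 2 × E →* G := MonoidHom.noncommCoprod ρ ι hcomm
  have hΦ : ∀ q e, Φ (q, e) = ρ q * ι e := fun q e => rfl
  refine ⟨E, inferInstance, fun e => Subtype.ext (hC2 e), ⟨(MulEquiv.ofBijective Φ ⟨?_, ?_⟩).symm⟩⟩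
  · rw [injective_iff_map_eq_one]
    rintro ⟨q, e⟩ h
    rw [hΦ, mul_eq_one_iff_eq_inv, ← map_inv] at h
    have hq := hρc q (by rw [h]; exact (hιC _).1) (by rw [h]; exact (hιC _).2)
    rcases hq with rfl | rfl
    · rw [map_one, eq_comm] at h
      have : e⁻¹ = 1 := Subtype.ext (Subtype.ext h)
      rw [inv_eq_one.1 this]; rfl
    · exfalso
      apply hzE
      have : z = (e⁻¹ : E).1 := Subtype.ext (hρz.symm.trans h)
      rw [this]
      exact (e⁻¹ : E).2
  · intro g
    obtain ⟨q, c, h1, h2, h3⟩ := exists_mem_centralizer_mul hinv hxy ρ hρ1 hρy g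
    have hcC : c ∈ C := (hC c).2 ⟨h1, h2⟩
    rcases hsplit ⟨c, hcC⟩ with he | he
    · refine ⟨(q, ⟨_, he⟩), ?_⟩
      rw [hΦ, h3]
      exact hcomm q ⟨_, he⟩
    -- If c lies outside E, then zc lies in E, and the factor `a 2`, which maps to z, compensates.
    · refine ⟨(.a 2 * q, ⟨_, he⟩), ?_⟩
      have hzz : x ^ 2 * x ^ 2 = 1 := by rw [← pow_add, hx4]
      have hι : ι ⟨_, he⟩ = x ^ 2 * c := rfl
      have hcz : c * x ^ 2 = x ^ 2 * c := ((show Commute c x from h1).pow_right 2).eq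
      rw [hΦ, (hcomm _ _).eq, hι, map_mul, hρz, h3, ← hcz, mul_assoc, ← mul_assoc (x ^ 2), hzz,
        one_mul]

end Hamiltonian

/-! ### The classification. -/

theorem mainTheorem1 (G : Type u) [Group G] [Finite G] :
    ((∃ n : ℕ, 1 ≤ n ∧ unitFiltration G n = ⊥) ↔
      (((∀ a b : G, a * b = b * a) ∧ IsCutGroup G) ∨
        ∃ (E : Type u) (_ : CommGroup E), (∀ e : E, e ^ 2 = 1) ∧
          Nonempty (G ≃* QuaternionGroup 2 × E))) ∧
    ((∀ a b : G, a * b = b * a) →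
      (IsCutGroup G ↔ (Monoid.exponent G ∣ 4 ∨ Monoid.exponent G ∣ 6))) := by
  have hab : (∀ a b : G, a * b = b * a) →
      (IsCutGroup G ↔ (Monoid.exponent G ∣ 4 ∨ Monoid.exponent G ∣ 6)) := by
    intro hcomm
    let : CommGroup G := { ‹Group G› with mul_comm := hcomm }
    exact isCutGroup_iff_exponent
  refine ⟨⟨?_, ?_⟩, hab⟩
  · rintro ⟨n, hn, hbot⟩
    have htors : ∀ u ∈ normalizedUnits G, IsOfFinOrder u := fun u hu =>
      isOfFinOrder_of_unitFiltration_eq_bot hn hbot hu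
    have hord : ∀ g : G, orderOf g ∣ 4 ∨ orderOf g ∣ 6 := by
      intro g
      by_contra hcon
      push Not at hcon
      obtain ⟨u, hu, hinf⟩ := exists_normalizedUnit_not_isOfFinOrder (isOfFinOrder_of_finite g)
        hcon.1 hcon.2
      exact hinf (htors u hu)
    by_cases hcomm : ∀ a b : G, a * b = b * a
    · refine Or.inl ⟨hcomm, (hab hcomm).2 ?_⟩
      let : CommGroup G := { ‹Group G› with mul_comm := hcomm }
      obtain ⟨g, hg⟩ :=
        Monoid.exists_orderOf_eq_exponent (Monoid.ExponentExists.of_finite (G := G))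
      have := hord g
      rwa [hg] at this
    · right
      push Not at hcomm
      obtain ⟨x, y, hxy⟩ := hcomm
      refine exists_mulEquiv_quaternionGroup_prod (fun a b hne => ?_) hxy
      obtain ⟨i, hi⟩ := exists_mul_eq_mul_pow htors a b
      rcases eq_or_eq_inv_of_conj (hord a) hi with h | h
      · rw [h] at hi; exact absurd hi hne
      · rw [hi, h]
  · rintro (⟨hcomm, hcut⟩ | ⟨E, _, hE, ⟨e⟩⟩)
    · let : CommGroup G := { ‹Group G› with mul_comm := hcomm }
      exact ⟨2, one_le_two, unitFiltration_two_eq_bot hcut⟩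
    -- Here n = 2 would fail: the central involution of K₈ is a commutator and so lies in 1 + Δ².
    · exact ⟨3, by norm_num, unitFiltration_three_eq_bot hE e⟩
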